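/- Let $\mathsf{Pk}$ be a countable set of packets, let $H$ be the (countable) set of packet histories, i.e. nonempty lists of packets, and let $2^H$ be the set of history sets, with the Borel $\sigma$-algebra $\mathcal B$ of the Cantor topology (generated by the sets $B_h=\{c : h\in c\}$ and their complements), which is also the Borel $\sigma$-algebra of the Scott topology of $(2^H,\subseteq)$. Order Markov kernels on $(2^H,\mathcal B)$ by $P\sqsubseteq Q$ iff $P(a,B)\le Q(a,B)$ for all $a\in 2^H$ and all Scott-open $B$. Call $P$ continuous if for every Scott-open $B$ the map $a\mapsto P(a,B)$ is Scott-continuous, i.e. is monotone and preserves suprema of nonempty directed sets. Let $1(a,-)=\delta_a$, $(P;Q)(a,A)=\int P(a,db)\,Q(b,A)$ and $(P\mathbin{\&}Q)(a,A)=(P(a,-)\times Q(a,-))(\{(b_1,b_2): b_1\cup b_2\in A\})$. Let $P^{(0)}=1$ and $P^{(n+1)}=1\mathbin{\&}(P;P^{(n)})$. For a Markov kernel $P$, let $P^{\circledast}$ be the iterate defined by the infinite stochastic process: $P^{\circledast}(a,A)=\Pr\bigl(\bigcup_{n\ge 0}c_n\in A\bigr)$, where $c_0,c_1,c_2,\dots$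 is the Markov chain with $c_0=a$ in which $c_{n+1}$ is drawn from $P(c_n,-)$. Then for every continuous Markov kernel $P$, the kernel $P^{\circledast}$ is continuous, and, in the poset of continuous Markov kernels ordered by $\sqsubseteq$, $$P^{\circledast}=\bigsqcup_{n}P^{(n)}=P^{*},$$ that is, $P^{\circledast}$ is the least upper bound of the approximants $P^{(n)}$, and it is the least fixpoint $P^{*}$ of the map $Q\mapsto 1\mathbin{\&}(P;Q)$. -/

import Mathlib

open MeasureTheory ProbabilityTheory Set Topology

/-- A packet history: a nonempty list of packets, head packet first. -/
abbrev Hist (Pk : Type*) : Type _ := {l : List Pk // l ≠ []}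

namespace ProbNetKAT

variable {H : Type*}

/-! History sets `Set H` carry Mathlib's measurable structure on `Set H`: the smallest σ-algebra
for which all maps `a ↦ (h ∈ a)` are measurable. For countable `H` it is the Borel σ-algebra both
of the Cantor and of the Scott topology, see `borel_cantor` and `borel_scott` below. -/

/-- The Cantor topology on history sets, generated by the sets `B_h = {c | h ∈ c}` and their
complements. -/
abbrev cantorTopology (H : Type*) : TopologicalSpace (Set H) :=
  TopologicalSpace.generateFrom
    {U | ∃ h : H, U = {c : Set H | h ∈ c} ∨ U = {c : Set H | h ∉ c}}

/-- The Scott topology of the directed complete partial order `(Set H, ⊆)`. -/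
abbrev scottTopology (H : Type*) : TopologicalSpace (Set H) :=
  Topology.scott (Set H) Set.univ

/-- `B` is a Scott-open set of history sets. -/
def ScottOpen (B : Set (Set H)) : Prop := IsOpen[scottTopology H] B

theorem scottOpen_iff (B : Set (Set H)) : ScottOpen B ↔ IsUpperSet B ∧ DirSupInacc B := by
  let _ := scottTopology H
  have : Topology.IsScott (Set H) Set.univ := ⟨rfl⟩
  have := Topology.IsScott.isOpen_iff_isUpperSet_and_dirSupInaccOn (D := Set.univ) (s := B)
  rw [dirSupInaccOn_univ] at this
  exact this

theorem scottOpen_mem (h : H) : ScottOpen {c : Set H | h ∈ c} := by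
  rw [scottOpen_iff]
  refine ⟨fun a b hab ha => hab ha, ?_⟩
  intro d _ _ a hlub ha
  have : a = ⋃₀ d := hlub.unique (isLUB_sSup d)
  rw [this] at ha
  obtain ⟨t, htd, ht⟩ := ha
  exact ⟨t, htd, ht⟩

/-- A Scott-open set is the union of the basic sets `B_F = {c | F ⊆ c}` it contains. -/
theorem ScottOpen.eq_iUnion {B : Set (Set H)} (hB : ScottOpen B) :
    B = ⋃ F ∈ {F : Finset H | (F : Set H) ∈ B}, {c : Set H | (F : Set H) ⊆ c} := by
  obtain ⟨hup, hsup⟩ := (scottOpen_iff B).1 hB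
  ext c
  simp only [mem_iUnion, exists_prop]
  constructor
  · intro hc
    obtain ⟨t, ⟨F, hF, rfl⟩, htB⟩ := hsup (d := {t | ∃ F : Finset H, (F : Set H) ⊆ c ∧ ↑F = t})
      ⟨_, ∅, by simp, rfl⟩
      (by
        classical
        rintro _ ⟨F, hF, rfl⟩ _ ⟨G, hG, rfl⟩
        exact ⟨_, ⟨F ∪ G, by simp [hF, hG], rfl⟩, by simp, by simp⟩)
      (a := c)
      (by
        constructor
        · rintro _ ⟨F, hF, rfl⟩
          exact hF
        · intro b hb x hx
          exact hb ⟨{x}, by simpa using hx, rfl⟩ (by simp)) hc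
    exact ⟨F, htB, hF⟩
  · rintro ⟨F, hF, hFc⟩
    exact hup hFc hF

theorem measurableSet_subset (F : Finset H) : MeasurableSet {c : Set H | (F : Set H) ⊆ c} := by
  have : {c : Set H | (F : Set H) ⊆ c} = ⋂ h ∈ F, {c : Set H | h ∈ c} := by
    ext c
    simp [Set.subset_def]
  rw [this]
  exact Finset.measurableSet_biInter F fun h _ => measurableSet_mem h

theorem ScottOpen.measurableSet [Countable H] {B : Set (Set H)} (hB : ScottOpen B) :
    MeasurableSet B := by
  rw [hB.eq_iUnion]
  exact MeasurableSet.biUnion (Set.to_countable _) fun F _ => measurableSet_subset F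

theorem le_of_measurableSet_mem (m : MeasurableSpace (Set H))
    (hm : ∀ h : H, MeasurableSet[m] {c : Set H | h ∈ c}) : Set.instMeasurableSpace ≤ m := by
  have h1 : @Measurable _ _ m Set.instMeasurableSpace (id : Set H → Set H) := by
    rw [@measurable_set_iff]
    intro h
    exact @measurable_to_prop _ m _ (by simpa [Set.preimage] using hm h)
  intro s hs
  exact h1 hs

/-- The σ-algebra on history sets is the Borel σ-algebra of the Scott topology. -/
theorem borel_scott [Countable H] :
    @borel (Set H) (scottTopology H) = Set.instMeasurableSpace := by
  apply le_antisymm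
  · exact MeasurableSpace.generateFrom_le fun B hB => ScottOpen.measurableSet hB
  · exact le_of_measurableSet_mem _ fun h =>
      MeasurableSpace.measurableSet_generateFrom (scottOpen_mem h)

/-- The σ-algebra on history sets is the Borel σ-algebra of the Cantor topology. -/
theorem borel_cantor [Countable H] :
    @borel (Set H) (cantorTopology H) = Set.instMeasurableSpace := by
  let _ := cantorTopology H
  have hopen : ∀ h : H, IsOpen {c : Set H | h ∈ c} := fun h =>
    TopologicalSpace.isOpen_generateFrom_of_mem ⟨h, Or.inl rfl⟩
  apply le_antisymm
  · have hc : {U : Set (Set H) | ∃ h : H, U = {c : Set H | h ∈ c} ∨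
        U = {c : Set H | h ∉ c}}.Countable := by
      refine ((Set.countable_range fun h : H => {c : Set H | h ∈ c}).union
        (Set.countable_range fun h : H => {c : Set H | h ∉ c})).mono ?_
      rintro U ⟨h, rfl | rfl⟩
      · exact Or.inl ⟨h, rfl⟩
      · exact Or.inr ⟨h, rfl⟩
    have : SecondCountableTopology (Set H) := ⟨_, hc, rfl⟩
    rw [borel_eq_generateFrom_of_subbasis (rfl : cantorTopology H = _)]
    refine MeasurableSpace.generateFrom_le ?_
    rintro U ⟨h, rfl | rfl⟩
    · exact measurableSet_mem h
    · exact measurableSet_notMem h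
  · exact le_of_measurableSet_mem _ fun h =>
      MeasurableSpace.measurableSet_generateFrom (hopen h)

/-- Markov kernels on history sets: `P a A` is the probability that the output set lies in the
measurable set `A` when the input set is `a`. -/
structure MKernel (H : Type*) where
  /-- the underlying kernel -/
  ker : Kernel (Set H) (Set H)
  /-- all its values are probability measures -/
  isMarkov : IsMarkovKernel ker

instance (P : MKernel H) : IsMarkovKernel P.ker := P.isMarkov

/-- `P ≤ Q` iff `P(a, B) ≤ Q(a, B)` for all history sets `a` and all Scott-open `B`. -/
instance [Countable H] : PartialOrder (MKernel H) where
  le P Q := ∀ a : Set H, ∀ B : Set (Set H), ScottOpen B → P.ker a B ≤ Q.ker a B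
  le_refl _ _ _ _ := le_rfl
  le_trans _ _ _ h₁ h₂ a B hB := (h₁ a B hB).trans (h₂ a B hB)
  le_antisymm P Q h₁ h₂ := by
    obtain ⟨P, hP⟩ := P
    obtain ⟨Q, hQ⟩ := Q
    congr
    ext1 a
    let _ := scottTopology H
    refine ext_of_generate_finite {B : Set (Set H) | ScottOpen B} borel_scott.symm
      (fun s hs t ht _ => IsOpen.inter (s := s) (t := t) hs ht) (fun B hB => le_antisymm (h₁ a B hB) (h₂ a B hB)) ?_
    simp

/-- A kernel is continuous if it is Scott-continuous in its first argument: for every Scott-open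
`B`, the map `a ↦ P(a, B)` is monotone and preserves directed suprema. -/
def MKernel.IsContinuous (P : MKernel H) : Prop :=
  ∀ B : Set (Set H), ScottOpen B → ScottContinuous fun a => P.ker a B

theorem measurable_union : Measurable fun p : Set H × Set H => p.1 ∪ p.2 := by
  rw [measurable_set_iff]
  intro h
  exact ((measurable_set_mem h).comp measurable_fst).or ((measurable_set_mem h).comp measurable_snd)

theorem measurable_iUnion : Measurable fun x : ℕ → Set H => ⋃ n, x n := by
  rw [measurable_set_iff]
  intro h
  simp only [mem_iUnion]
  exact Measurable.exists fun n => (measurable_set_mem h).comp (measurable_pi_apply n)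

namespace MKernel

/-- The program `1` (skip): the output is the input. -/
noncomputable def skip : MKernel H := ⟨Kernel.id, inferInstance⟩

/-- Sequential composition `(P ; Q)(a, A) = ∫ Q(b, A) P(a, db)`. -/
noncomputable def seq (P Q : MKernel H) : MKernel H := ⟨Q.ker ∘ₖ P.ker, inferInstance⟩

/-- Parallel composition `(P & Q)(a, A) = (P(a, -) × Q(a, -)) {(b₁, b₂) | b₁ ∪ b₂ ∈ A}`. -/
noncomputable def par (P Q : MKernel H) : MKernel H :=
  ⟨(P.ker ×ₖ Q.ker).map fun p => p.1 ∪ p.2, Kernel.IsMarkovKernel.map _ measurable_union⟩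

/-- The transformation `Q ↦ 1 & (P ; Q)`. -/
noncomputable def iterStep (P Q : MKernel H) : MKernel H := par skip (seq P Q)

/-- The approximants `P⁽⁰⁾ = 1` and `P⁽ⁿ⁺¹⁾ = 1 & (P ; P⁽ⁿ⁾)`. -/
noncomputable def approx (P : MKernel H) : ℕ → MKernel H
  | 0 => skip
  | n + 1 => iterStep P (approx P n)

/-- The law of the Markov chain `c₀, c₁, c₂, …` with `c₀` the given input and `cₙ₊₁` drawn from
`P(cₙ, -)`, on the space of infinite sequences of history sets (Ionescu-Tulcea). -/
noncomputable def process (P : MKernel H) : Kernel (Set H) (ℕ → Set H) :=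
  (Kernel.traj (X := fun _ => Set H)
    (fun n => P.ker.comap
      (fun x : (i : Finset.Iic n) → Set H => x ⟨n, Finset.mem_Iic.2 le_rfl⟩)
      (measurable_pi_apply _)) 0).comap
    (fun c _ => c) (measurable_pi_lambda _ fun _ => measurable_id)

instance (P : MKernel H) : IsMarkovKernel (process P) := by
  unfold process
  infer_instance

/-- The iterate `P^⊛` defined by the infinite stochastic process: the law of `⋃ₙ cₙ`, where
`c₀, c₁, c₂, …` is the chain described by `process P`. -/
noncomputable def processStar (P : MKernel H) : MKernel H :=
  ⟨(process P).map fun x => ⋃ n, x n, Kernel.IsMarkovKernel.map _ measurable_iUnion⟩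

end MKernel

end ProbNetKAT

namespace ProbNetKAT

open scoped ENNReal

variable {H : Type*}

/-! The approximant `P.approx n` is the law of `c₀ ∪ … ∪ cₙ` (`approx_apply`), and these partial
unions increase to `⋃ cₙ`. A Scott-open `B` contains an increasing union iff it contains some stage,
so continuity of measure from below gives `P.processStar.ker a B = ⨆ n, (P.approx n).ker a B`
(`processStar_apply`).

This formula makes `processStar` the least upper bound of the approximants; with monotone
convergence it gives the fixpoint equation. A fixpoint lies above `skip`, hence by induction above
every approximant, hence above `processStar`. Continuity of `P` serves only to make the approximants
continuous (`IsContinuous.iterStep`, through `scottContinuous_lintegral`); continuity then passes to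
their supremum. -/

/-! ### Scott continuity on a countable powerset -/

theorem ScottOpen.isUpperSet {B : Set (Set H)} (hB : ScottOpen B) : IsUpperSet B :=
  ((scottOpen_iff B).1 hB).1

theorem ScottOpen.exists_mem_of_iUnion_mem {B : Set (Set H)} (hB : ScottOpen B)
    {s : ℕ → Set H} (hs : Monotone s) (h : ⋃ n, s n ∈ B) : ∃ n, s n ∈ B := by
  obtain ⟨_, ⟨n, rfl⟩, hn⟩ := ((scottOpen_iff B).1 hB).2 (Set.range_nonempty s)
    hs.directed_le.directedOn_range isLUB_iSup h
  exact ⟨n, hn⟩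

/-- In a countable set, an `ω`-chain criterion for Scott continuity on the powerset. -/
theorem scottContinuous_of_forall_iUnion_le [Countable H] {f : Set H → ℝ≥0∞} (hmono : Monotone f)
    (h : ∀ s : ℕ → Set H, Monotone s → f (⋃ n, s n) ≤ ⨆ n, f (s n)) : ScottContinuous f := by
  intro d hne hdir a hlub
  refine ⟨?_, fun c hc => ?_⟩
  · rintro _ ⟨t, ht, rfl⟩
    exact hmono (hlub.1 ht)
  obtain ⟨e, he⟩ := exists_injective_nat H
  have ha : a = ⋃₀ d := hlub.unique (isLUB_sSup d)
  -- Countability exhausts `a` by an increasing sequence of finite sets; by directedness each finite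
  -- piece lies inside a single member of `d`.
  have hunion : ⋃ n, a ∩ {x | e x ≤ n} = a := by
    ext x
    simpa using fun _ => ⟨e x, le_rfl⟩
  rw [← hunion]
  refine (h (fun n => a ∩ {x | e x ≤ n})
    fun m n hmn x hx => ⟨hx.1, le_trans hx.2 hmn⟩).trans (iSup_le fun n => ?_)
  have hfin : (a ∩ {x | e x ≤ n}).Finite :=
    ((Set.finite_Iic n).preimage he.injOn).subset inter_subset_right
  obtain ⟨t, htd, ht⟩ := hdir.exists_mem_subset_of_finite_of_subset_sUnion hne hfin
    (by rw [← ha]; exact inter_subset_left)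
  exact (hmono ht).trans (hc ⟨t, htd, rfl⟩)

theorem ScottContinuous.map_iUnion {f : Set H → ℝ≥0∞} (hf : ScottContinuous f)
    {s : ℕ → Set H} (hs : Monotone s) : f (⋃ n, s n) = ⨆ n, f (s n) := by
  have := hf (Set.range_nonempty s) hs.directed_le.directedOn_range
    (a := ⋃ n, s n) isLUB_iSup
  rw [← Set.range_comp] at this
  exact this.unique isLUB_iSup

theorem ScottContinuous.scottOpen_lt {f : Set H → ℝ≥0∞} (hf : ScottContinuous f) (t : ℝ≥0∞) :
    ScottOpen {b | t < f b} := by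
  rw [scottOpen_iff]
  refine ⟨fun a b hab ha => lt_of_lt_of_le ha (hf.monotone hab), fun d hne hdir a hlub ha => ?_⟩
  obtain ⟨_, ⟨b, hb, rfl⟩, hlt⟩ := (lt_isLUB_iff (hf hne hdir hlub)).1 ha
  exact ⟨b, hb, hlt⟩

theorem ScottContinuous.measurable [Countable H] {f : Set H → ℝ≥0∞} (hf : ScottContinuous f) :
    Measurable f :=
  measurable_of_Ioi fun t => (ScottContinuous.scottOpen_lt hf t).measurableSet

theorem scottContinuous_iSup {f : ℕ → Set H → ℝ≥0∞}
    (hf : ∀ n, ScottContinuous (f n)) : ScottContinuous fun a => ⨆ n, f n a := by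
  intro d hne hdir a hlub
  refine ⟨?_, fun c hc => iSup_le fun n => (hf n hne hdir hlub).2 ?_⟩
  · rintro _ ⟨t, ht, rfl⟩
    exact iSup_mono fun n => (hf n).monotone (hlub.1 ht)
  · rintro _ ⟨t, ht, rfl⟩
    exact (le_iSup (fun n => f n t) n).trans (hc ⟨t, ht, rfl⟩)

theorem measurable_union_left (a : Set H) : Measurable fun x : Set H => a ∪ x :=
  measurable_union.comp measurable_prodMk_left

theorem measurableSet_preimage_union_left {B : Set (Set H)} (hB : MeasurableSet B) (a : Set H) :
    MeasurableSet {x | a ∪ x ∈ B} :=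
  measurable_union_left a hB

theorem ScottOpen.preimage_union_left {B : Set (Set H)} (hB : ScottOpen B) (a : Set H) :
    ScottOpen {x | a ∪ x ∈ B} := by
  rw [scottOpen_iff]
  refine ⟨fun x y hxy hx => hB.isUpperSet (union_subset_union_right a hxy) hx,
    fun d hne hdir c hlub hc => ?_⟩
  have hdir' : DirectedOn (· ≤ ·) ((fun x => a ∪ x) '' d) := by
    rintro _ ⟨x, hx, rfl⟩ _ ⟨y, hy, rfl⟩
    obtain ⟨z, hz, hxz, hyz⟩ := hdir x hx y hy
    exact ⟨_, ⟨z, hz, rfl⟩, union_subset_union_right a hxz, union_subset_union_right a hyz⟩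
  have hlub' : IsLUB ((fun x => a ∪ x) '' d) (a ∪ c) := by
    refine ⟨?_, fun u hu => union_subset ?_ (hlub.2 fun x hx => ?_)⟩
    · rintro _ ⟨x, hx, rfl⟩
      exact union_subset_union_right a (hlub.1 hx)
    · obtain ⟨x, hx⟩ := hne
      exact subset_union_left.trans (hu ⟨x, hx, rfl⟩)
    · exact subset_union_right.trans (hu ⟨x, hx, rfl⟩)
  obtain ⟨_, ⟨x, hx, rfl⟩, hxB⟩ := ((scottOpen_iff B).1 hB).2 (hne.image _) hdir' hlub' hc
  exact ⟨x, hx, hxB⟩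

/-- The measure of a Scott-open set of unions is the supremum along an `ω`-chain. -/
theorem ScottOpen.measure_preimage_iUnion_union [Countable H] {B : Set (Set H)} (hB : ScottOpen B)
    (μ : Measure (Set H)) {s : ℕ → Set H} (hs : Monotone s) :
    μ {x | (⋃ n, s n) ∪ x ∈ B} = ⨆ n, μ {x | s n ∪ x ∈ B} := by
  have hmono : Monotone fun n => {x | s n ∪ x ∈ B} := fun m n hmn x hx =>
    hB.isUpperSet (union_subset_union_left x (hs hmn)) hx
  rw [← hmono.measure_iUnion]
  congr 1
  ext x
  simp only [mem_ofPred_eq, mem_iUnion]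
  constructor
  · rw [iUnion_union]
    exact hB.exists_mem_of_iUnion_mem fun m n hmn => union_subset_union_left x (hs hmn)
  · rintro ⟨n, hn⟩
    exact hB.isUpperSet (union_subset_union_left x (subset_iUnion s n)) hn

namespace MKernel

/-! ### The operator `Q ↦ 1 & (P ; Q)` preserves order and continuity -/

theorem measurable_ker_preimage_union (Q : MKernel H) {B : Set (Set H)} (hB : MeasurableSet B) :
    Measurable fun p : Set H × Set H => Q.ker p.2 {x | p.1 ∪ x ∈ B} := by
  have h := Kernel.measurable_kernel_prodMk_left (κ := Q.ker.comap Prod.snd measurable_snd)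
    (t := {q : (Set H × Set H) × Set H | q.1.1 ∪ q.2 ∈ B})
    (measurable_union.comp ((measurable_fst.comp measurable_fst).prodMk measurable_snd) hB)
  exact h

theorem skip_apply (a : Set H) : (skip : MKernel H).ker a = Measure.dirac a := Kernel.id_apply a

/-- The first factor of the product is the Dirac mass at `a`, so the product integral collapses. -/
theorem iterStep_apply (P Q : MKernel H) (a : Set H) {B : Set (Set H)} (hB : MeasurableSet B) :
    (P.iterStep Q).ker a B = ∫⁻ b, Q.ker b {x | a ∪ x ∈ B} ∂P.ker a := by
  have hB' : MeasurableSet {x | a ∪ x ∈ B} := measurable_union_left a hB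
  change ((Kernel.id ×ₖ (Q.ker ∘ₖ P.ker)).map fun p : Set H × Set H => p.1 ∪ p.2) a B = _
  rw [Kernel.map_apply' _ measurable_union _ hB,
    Kernel.id_prod_apply' _ _ (measurable_union hB)]
  exact Kernel.comp_apply' _ _ _ hB'

theorem iterStep_mono [Countable H] (P : MKernel H) {Q R : MKernel H} (h : Q ≤ R) :
    P.iterStep Q ≤ P.iterStep R := by
  intro a B hB
  rw [iterStep_apply P Q a hB.measurableSet, iterStep_apply P R a hB.measurableSet]
  exact lintegral_mono fun b => h b _ (hB.preimage_union_left a)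

/-- Layer cake: the superlevel sets of `f` are Scott-open, so the integral over `b` becomes a
Lebesgue integral over levels `t` of functions Scott-continuous in `a`, and monotone convergence
applies. Finiteness of `f` allows real levels. -/
theorem IsContinuous.scottContinuous_lintegral [Countable H] {P : MKernel H} (hP : P.IsContinuous)
    {f : Set H → ℝ≥0∞} (hf : ScottContinuous f) (hfin : ∀ b, f b ≠ ∞) :
    ScottContinuous fun a => ∫⁻ b, f b ∂P.ker a := by
  have hopen : ∀ t : ℝ, 0 ≤ t → ScottOpen {b | t < (f b).toReal} := fun t ht => by
    simpa only [ENNReal.ofReal_lt_iff_lt_toReal ht (hfin _)] using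
      ScottContinuous.scottOpen_lt hf (ENNReal.ofReal t)
  have hlayer : ∀ a, ∫⁻ b, f b ∂P.ker a =
      ∫⁻ t in Ioi (0 : ℝ), P.ker a {b | t < (f b).toReal} := fun a => by
    rw [← lintegral_eq_lintegral_meas_lt _ (Filter.Eventually.of_forall fun _ =>
      ENNReal.toReal_nonneg) (ScottContinuous.measurable hf).ennreal_toReal.aemeasurable]
    exact lintegral_congr fun b => (ENNReal.ofReal_toReal (hfin b)).symm
  simp only [hlayer]
  refine scottContinuous_of_forall_iUnion_le (fun a a' haa' => ?_) fun s hs => le_of_eq ?_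
  · exact setLIntegral_mono' measurableSet_Ioi fun t ht => (hP _ (hopen t ht.le)).monotone haa'
  · have hanti : ∀ n, Antitone fun t : ℝ => P.ker (s n) {b | t < (f b).toReal} :=
      fun n t t' htt' => measure_mono fun b hb => lt_of_le_of_lt htt' hb
    rw [setLIntegral_congr_fun measurableSet_Ioi fun t (ht : 0 < t) =>
      ScottContinuous.map_iUnion (hP _ (hopen t ht.le)) hs]
    refine lintegral_iSup_ae (fun n => (hanti n).measurable) fun n => ?_
    refine (ae_restrict_iff' measurableSet_Ioi).2 (Filter.Eventually.of_forall fun t ht => ?_)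
    exact (hP _ (hopen t (le_of_lt ht))).monotone (hs n.le_succ)

theorem isContinuous_skip [Countable H] : (skip : MKernel H).IsContinuous := by
  intro B hB
  have hdirac : (fun a => (skip : MKernel H).ker a B) = B.indicator 1 := by
    funext a
    rw [skip_apply, Measure.dirac_apply' _ hB.measurableSet]
  rw [hdirac]
  intro d hne hdir a hlub
  refine ⟨?_, fun c hc => ?_⟩
  · rintro _ ⟨t, ht, rfl⟩
    by_cases h : t ∈ B
    · simp [h, hB.isUpperSet (hlub.1 ht) h]
    · simp [h]
  · by_cases ha : a ∈ B
    · obtain ⟨t, htd, htB⟩ := ((scottOpen_iff B).1 hB).2 hne hdir hlub ha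
      have := hc ⟨t, htd, rfl⟩
      simpa [ha, htB] using this
    · simp [ha]

/-- The input occurs twice, in the measure and in the integrand. Each occurrence is continuous with
the other frozen, and joint monotonicity reduces the double supremum to the diagonal. -/
theorem IsContinuous.iterStep [Countable H] {P Q : MKernel H} (hP : P.IsContinuous)
    (hQ : Q.IsContinuous) : (P.iterStep Q).IsContinuous := by
  intro B hB
  simp only [iterStep_apply P Q _ hB.measurableSet]
  have hsection : ∀ a, ScottContinuous fun a' => ∫⁻ b, Q.ker b {x | a ∪ x ∈ B} ∂P.ker a' :=
    fun a => hP.scottContinuous_lintegral (hQ _ (hB.preimage_union_left a))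
      fun b => measure_ne_top _ _
  have hleft : ∀ ⦃a a' : Set H⦄, a ⊆ a' → ∀ b,
      Q.ker b {x | a ∪ x ∈ B} ≤ Q.ker b {x | a' ∪ x ∈ B} := fun a a' h b =>
    measure_mono fun x hx => hB.isUpperSet (union_subset_union_left x h) hx
  refine scottContinuous_of_forall_iUnion_le (fun a a' haa' => ?_) fun s hs => ?_
  · exact ((hsection a).monotone haa').trans (lintegral_mono (hleft haa'))
  · rw [ScottContinuous.map_iUnion (hsection _) hs]
    refine iSup_le fun n => ?_
    simp only [hB.measure_preimage_iUnion_union _ hs]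
    rw [lintegral_iSup (fun m => Q.ker.measurable_coe
      (hB.preimage_union_left (s m)).measurableSet) fun i j hij b => hleft (hs hij) b]
    refine iSup_le fun m => le_iSup_of_le (max n m) ?_
    exact ((hsection (s m)).monotone (hs (le_max_left n m))).trans
      (lintegral_mono (hleft (hs (le_max_right n m))))

theorem IsContinuous.approx [Countable H] {P : MKernel H} (hP : P.IsContinuous) :
    ∀ n, (P.approx n).IsContinuous
  | 0 => isContinuous_skip
  | n + 1 => hP.iterStep (hP.approx n)

/-! ### The approximants as laws of partial unions of the chain -/

/-- The transition kernels of the chain, as functions of its history. -/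
noncomputable abbrev step (P : MKernel H) (n : ℕ) :
    Kernel ((i : Finset.Iic n) → (fun _ : ℕ => Set H) i) ((fun _ : ℕ => Set H) (n + 1)) :=
  P.ker.comap (fun x : (i : Finset.Iic n) → Set H => x ⟨n, Finset.mem_Iic.2 le_rfl⟩)
    (measurable_pi_apply _)

theorem process_apply (P : MKernel H) (a : Set H) :
    process P a = Kernel.traj (X := fun _ => Set H) P.step 0 fun _ => a := by
  rw [process, Kernel.comap_apply]

/-- One step of the Markov chain, given its history. -/
theorem lintegral_process_succ (P : MKernel H) (a : Set H) (k : ℕ)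
    {f : ((i : Finset.Iic k) → Set H) × Set H → ℝ≥0∞} (hf : Measurable f) :
    ∫⁻ x, f (Preorder.frestrictLe k x, x (k + 1)) ∂process P a =
      ∫⁻ x, ∫⁻ b, f (Preorder.frestrictLe k x, b) ∂P.ker (x k) ∂process P a := by
  have h := Kernel.partialTraj_compProd_eq_map_traj (X := fun _ => Set H) (κ := P.step)
    (Nat.zero_le k) (x₀ := fun _ => a)
  rw [process_apply, ← lintegral_map (μ := Kernel.traj (X := fun _ => Set H) P.step 0 fun _ => a)
    hf (by fun_prop), ← h, Measure.lintegral_compProd hf,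
    ← Kernel.traj_map_frestrictLe_apply, lintegral_map _ (by fun_prop)]
  · rfl
  · exact hf.lintegral_kernel_prod_right'

theorem process_map_zero (P : MKernel H) (a : Set H) :
    (process P a).map (fun x => x 0) = Measure.dirac a := by
  have h := Kernel.traj_map_frestrictLe_apply (X := fun _ => Set H) (κ := P.step) 0 0 fun _ => a
  rw [Kernel.partialTraj_self, Kernel.id_apply] at h
  have h0 : (fun x : ℕ → Set H => x 0) =
      (fun y : (i : Finset.Iic 0) → Set H => y ⟨0, Finset.mem_Iic.2 le_rfl⟩) ∘
        Preorder.frestrictLe (π := fun _ => Set H) 0 := rfl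
  rw [process_apply, h0, ← Measure.map_map (by fun_prop) (by fun_prop), h,
    Measure.map_dirac' (by fun_prop)]

/-- Run the chain for `k` steps, then let `P.approx m` finish from `x k`: the result depends only on
`k + m`. The union stops before `x k` because `P.approx m` already includes its own input. -/
theorem lintegral_approx_process (P : MKernel H) (a : Set H) {B : Set (Set H)}
    (hB : MeasurableSet B) (k m : ℕ) :
    ∫⁻ x, (P.approx m).ker (x k) {y | (⋃ i < k, x i) ∪ y ∈ B} ∂process P a =
      (P.approx (k + m)).ker a B := by
  induction k generalizing m with
  | zero =>
    have := lintegral_map (μ := process P a) ((P.approx m).ker.measurable_coe hB)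
      (measurable_pi_apply 0)
    rw [process_map_zero, lintegral_dirac' _ ((P.approx m).ker.measurable_coe hB)] at this
    simpa using this.symm
  | succ k ih =>
    have hunion : Measurable fun y : (i : Finset.Iic k) → Set H => ⋃ i, y i := by
      rw [measurable_set_iff]
      intro h
      simp only [mem_iUnion]
      exact Measurable.exists fun i => (measurable_set_mem h).comp (measurable_pi_apply i)
    have hrestrict : ∀ x : ℕ → Set H,
        ⋃ i, Preorder.frestrictLe (π := fun _ => Set H) k x i = (⋃ i < k, x i) ∪ x k := by
      intro x
      rw [← biUnion_lt_succ]
      ext h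
      simp
    have hstep := lintegral_process_succ P a k
      (f := fun p => (P.approx m).ker p.2 {y | (⋃ i, p.1 i) ∪ y ∈ B})
      ((measurable_ker_preimage_union _ hB).comp
        ((hunion.comp measurable_fst).prodMk measurable_snd))
    simp only [hrestrict] at hstep
    simp only [biUnion_lt_succ]
    -- Integrating out the last transition turns `P.approx m` at `x (k + 1)` into `P.approx (m + 1)`
    -- at `x k`.
    rw [hstep, show k + 1 + m = k + (m + 1) by omega, ← ih (m + 1)]
    refine lintegral_congr fun x => ?_
    rw [show P.approx (m + 1) = P.iterStep (P.approx m) from rfl,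
      iterStep_apply _ _ _ (measurableSet_preimage_union_left hB _)]
    simp only [mem_ofPred_eq, union_assoc]

theorem measurable_biUnion_lt (k : ℕ) : Measurable fun x : ℕ → Set H => ⋃ i < k, x i := by
  rw [measurable_set_iff]
  intro h
  simp only [mem_iUnion]
  exact Measurable.exists fun i => Measurable.exists fun _ =>
    (measurable_set_mem h).comp (measurable_pi_apply i)

/-- The `n`-th approximant is the law of the union of the first `n + 1` states of the chain. -/
theorem approx_apply (P : MKernel H) (a : Set H) {B : Set (Set H)} (hB : MeasurableSet B) (n : ℕ) :
    (P.approx n).ker a B = process P a {x | (⋃ i < n + 1, x i) ∈ B} := by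
  have hmeas : MeasurableSet {x : ℕ → Set H | (⋃ i < n + 1, x i) ∈ B} :=
    measurable_biUnion_lt (n + 1) hB
  have h := lintegral_approx_process P a hB n 0
  rw [add_zero] at h
  rw [← h, ← lintegral_indicator_one hmeas]
  refine lintegral_congr fun x => ?_
  rw [show P.approx 0 = skip from rfl, skip_apply,
    Measure.dirac_apply' _ (measurableSet_preimage_union_left hB _)]
  simp only [biUnion_lt_succ]
  rfl

/-! ### The iterate as supremum and least fixpoint -/

theorem processStar_apply [Countable H] (P : MKernel H) (a : Set H) {B : Set (Set H)}
    (hB : ScottOpen B) : P.processStar.ker a B = ⨆ n, (P.approx n).ker a B := by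
  have hinc : ∀ x : ℕ → Set H, Monotone fun n => ⋃ i < n + 1, x i := fun x m n hmn =>
    biUnion_subset_biUnion_left fun i (hi : i < m + 1) => show i < n + 1 by omega
  have hunion : ∀ x : ℕ → Set H, ⋃ n, x n = ⋃ n, ⋃ i < n + 1, x i := fun x => by
    ext h
    simp only [mem_iUnion]
    exact ⟨fun ⟨n, hn⟩ => ⟨n, n, n.lt_succ_self, hn⟩, fun ⟨_, i, _, hi⟩ => ⟨i, hi⟩⟩
  have hmono : Monotone fun n => {x : ℕ → Set H | (⋃ i < n + 1, x i) ∈ B} := fun m n hmn x hx =>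
    hB.isUpperSet (hinc x hmn) hx
  simp only [approx_apply P a hB.measurableSet]
  rw [← hmono.measure_iUnion]
  change ((process P).map fun x => ⋃ n, x n) a B = _
  rw [Kernel.map_apply' _ measurable_iUnion _ hB.measurableSet]
  congr 1
  ext x
  simp only [mem_preimage, mem_iUnion (s := fun n => {x : ℕ → Set H | (⋃ i < n + 1, x i) ∈ B}),
    mem_ofPred_eq]
  rw [hunion]
  exact ⟨hB.exists_mem_of_iUnion_mem (hinc x), fun ⟨n, hn⟩ =>
    hB.isUpperSet (subset_iUnion (fun n => ⋃ i < n + 1, x i) n) hn⟩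

theorem approx_monotone [Countable H] (P : MKernel H) : Monotone P.approx := by
  refine monotone_nat_of_le_succ fun n a B hB => ?_
  rw [approx_apply P a hB.measurableSet, approx_apply P a hB.measurableSet]
  refine measure_mono fun x hx => hB.isUpperSet ?_ hx
  exact biUnion_subset_biUnion_left fun i (hi : i < n + 1) => show i < n + 1 + 1 by omega

theorem skip_le_iterStep [Countable H] (P Q : MKernel H) : skip ≤ P.iterStep Q := by
  intro a B hB
  rw [skip_apply, Measure.dirac_apply' _ hB.measurableSet, iterStep_apply P Q a hB.measurableSet]
  by_cases ha : a ∈ B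
  -- Scott-open sets are upper sets, so adding outputs to `a ∈ B` never leaves `B`.
  · have huniv : {x | a ∪ x ∈ B} = univ :=
      eq_univ_of_forall fun x => hB.isUpperSet subset_union_left ha
    simp [ha, huniv]
  · simp [ha]

theorem approx_le_of_iterStep_eq [Countable H] {P Q : MKernel H} (h : P.iterStep Q = Q) :
    ∀ n, P.approx n ≤ Q
  | 0 => (skip_le_iterStep P Q).trans_eq h
  | n + 1 => (P.iterStep_mono (approx_le_of_iterStep_eq h n)).trans_eq h

theorem iterStep_processStar [Countable H] (P : MKernel H) :
    P.iterStep P.processStar = P.processStar := by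
  have key : ∀ a B, ScottOpen B → (P.iterStep P.processStar).ker a B = P.processStar.ker a B := by
    intro a B hB
    rw [iterStep_apply _ _ _ hB.measurableSet, processStar_apply P a hB]
    simp only [P.processStar_apply _ (hB.preimage_union_left a)]
    rw [lintegral_iSup (fun n => (P.approx n).ker.measurable_coe
        (hB.preimage_union_left a).measurableSet)
      fun m n hmn b => P.approx_monotone hmn b _ (hB.preimage_union_left a)]
    have hsucc : ∀ n, ∫⁻ b, (P.approx n).ker b {x | a ∪ x ∈ B} ∂P.ker a =
        (P.approx (n + 1)).ker a B := fun n => (iterStep_apply P _ a hB.measurableSet).symm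
    simp only [hsucc]
    exact Monotone.iSup_nat_add (f := fun n => (P.approx n).ker a B)
      (fun m n hmn => P.approx_monotone hmn a B hB) 1
  -- Agreement on Scott-open sets suffices: they form a π-system generating the σ-algebra, which is
  -- what antisymmetry of the order encodes.
  exact le_antisymm (fun a B hB => (key a B hB).le) fun a B hB => (key a B hB).ge

theorem IsContinuous.processStar [Countable H] {P : MKernel H} (hP : P.IsContinuous) :
    P.processStar.IsContinuous := by
  intro B hB
  simp only [P.processStar_apply _ hB]
  exact scottContinuous_iSup fun n => hP.approx n B hB

theorem approx_le_processStar [Countable H] (P : MKernel H) (n : ℕ) :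
    P.approx n ≤ P.processStar := fun a B hB => by
  rw [P.processStar_apply a hB]
  exact le_iSup (fun n => (P.approx n).ker a B) n

theorem processStar_le [Countable H] {P Q : MKernel H} (h : ∀ n, P.approx n ≤ Q) :
    P.processStar ≤ Q := fun a B hB => by
  rw [P.processStar_apply a hB]
  exact iSup_le fun n => h n a B hB

end MKernel

end ProbNetKAT

theorem mainTheorem9 {Pk : Type*} [Countable Pk]
    (P : ProbNetKAT.MKernel (Hist Pk)) (hP : P.IsContinuous) :
    IsLeast {Q : ProbNetKAT.MKernel (Hist Pk) | Q.IsContinuous ∧ ∀ n : ℕ, P.approx n ≤ Q}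
        P.processStar ∧
      IsLeast {Q : ProbNetKAT.MKernel (Hist Pk) | Q.IsContinuous ∧ P.iterStep Q = Q}
        P.processStar :=
  ⟨⟨⟨hP.processStar, P.approx_le_processStar⟩, fun _ hQ => ProbNetKAT.MKernel.processStar_le hQ.2⟩,
    ⟨⟨hP.processStar, P.iterStep_processStar⟩, fun _ hQ => ProbNetKAT.MKernel.processStar_le
      (ProbNetKAT.MKernel.approx_le_of_iterStep_eq hQ.2)⟩⟩
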